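/- All graphs are simple, and a graph $G$ is regarded as a metric space by identifying every edge isometrically with the interval $[0,1]$ and taking as distance of two points (vertices or interior points of edges) the infimum of the lengths of the paths joining them. A geodesic triangle $T$ in a metric space $X$ consists of three points of $X$ and three geodesics (its sides), one joining each pair of these points. $T$ is $\delta$-thin if each side lies in the $\delta$-neighbourhood of the union of the other two sides, $\delta(T)$ is the infimum of the $\delta\ge 0$ for which $T$ is $\delta$-thin, and the hyperbolicity constant $\delta(X)$ is the supremum of $\delta(T)$ over all geodesic triangles $T$ in $X$. The direct product $G_1\times G_2$ has vertex set $V(G_1)\times V(G_2)$, with $(u_1,v_1)$ and $(u_2,v_2)$ adjacent if and only if $u_1u_2\in E(G_1)$ and $v_1v_2\in E(G_2)$. $C_m$ is the cycle graph with $m$ vertices and $P_n$ the path graph with $n$ vertices. **Theorem.** For every odd integer $m\ge 3$ and every integer $n\ge 2$, $$\delta(C_m\times P_n)=\begin{cases} m/2, & \text{if } n-1\le m,\\ (n-1)/2, & \text{if } m<n-1<2m,\\ m-1/2, & \text{if } n-1\ge 2m.\end{cases}$$ -/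

import Mathlib

open scoped ENNReal NNReal

namespace GromovHyp

/-- The direct (tensor, categorical) product of two simple graphs. -/
def directProd {V W : Type*} (G : SimpleGraph V) (H : SimpleGraph W) : SimpleGraph (V × W) where
  Adj x y := G.Adj x.1 y.1 ∧ H.Adj x.2 y.2
  symm := ⟨fun _ _ h => ⟨h.1.symm, h.2.symm⟩⟩
  loopless := ⟨fun x h => G.loopless.irrefl x.1 h.1⟩

/-- The points of the metric graph of `G`: the vertices `v`, and the points `(1 - t) u + t v`,
`0 ≤ t ≤ 1`, of the edges `[u, v]`, written in barycentric coordinates. -/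
@[ext]
structure MetricGraph {V : Type*} (G : SimpleGraph V) where
  coord : V →₀ ℝ
  mem : (∃ v, coord = Finsupp.single v 1) ∨
    ∃ u v, G.Adj u v ∧ ∃ t ∈ Set.Icc (0 : ℝ) 1,
      coord = Finsupp.single u (1 - t) + Finsupp.single v t

namespace MetricGraph

variable {V : Type*} {G : SimpleGraph V}

/-- A vertex, as a point of the metric graph. -/
noncomputable def vertex (G : SimpleGraph V) (v : V) : MetricGraph G :=
  ⟨Finsupp.single v 1, Or.inl ⟨v, rfl⟩⟩

/-- The point of the edge `[u, v]` at distance `t` from `u` along the edge. -/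
noncomputable def edgePoint {u v : V} (h : G.Adj u v) (t : Set.Icc (0 : ℝ) 1) : MetricGraph G :=
  ⟨Finsupp.single u (1 - (t : ℝ)) + Finsupp.single v (t : ℝ), Or.inr ⟨u, v, h, t, t.2, rfl⟩⟩

/-- `HasPath p q ℓ`: there is a path of length `ℓ` from `p` to `q`, made of finitely many
segments, each contained in one edge; every edge is identified with the unit interval. -/
inductive HasPath : MetricGraph G → MetricGraph G → ℝ≥0 → Prop
  | refl (p : MetricGraph G) : HasPath p p 0
  | step {u v : V} (h : G.Adj u v) (s t : Set.Icc (0 : ℝ) 1) {q : MetricGraph G} {ℓ : ℝ≥0} :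
      HasPath (edgePoint h t) q ℓ → HasPath (edgePoint h s) q (nndist s t + ℓ)

theorem HasPath.trans {p q r : MetricGraph G} {a b : ℝ≥0} (h₁ : HasPath p q a)
    (h₂ : HasPath q r b) : HasPath p r (a + b) := by
  induction h₁ with
  | refl p => simpa using h₂
  | step h s t _ ih => rw [add_assoc]; exact HasPath.step h s t (ih h₂)

theorem HasPath.symm {p q : MetricGraph G} {a : ℝ≥0} (h : HasPath p q a) : HasPath q p a := by
  induction h with
  | refl p => exact HasPath.refl p
  | step h s t _ ih =>
    have := ih.trans (HasPath.step h t s (HasPath.refl _))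
    rwa [add_zero, nndist_comm, add_comm] at this

/-- The distance of two points is the infimum of the lengths of the paths that join them
(`∞` if there is none). -/
noncomputable instance : PseudoEMetricSpace (MetricGraph G) where
  edist p q := ⨅ (ℓ : ℝ≥0) (_ : HasPath p q ℓ), (ℓ : ℝ≥0∞)
  edist_self p := le_antisymm (iInf₂_le_of_le 0 (HasPath.refl p) (by simp)) zero_le
  edist_comm p q := le_antisymm
    (le_iInf₂ fun ℓ h => iInf₂_le_of_le ℓ h.symm le_rfl)
    (le_iInf₂ fun ℓ h => iInf₂_le_of_le ℓ h.symm le_rfl)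
  edist_triangle p q r := by
    simp only [ENNReal.iInf_add, ENNReal.add_iInf]
    exact le_iInf₂ fun b hb => le_iInf₂ fun a ha =>
      iInf₂_le_of_le _ (ha.trans hb) (by simp)

end MetricGraph

section Hyperbolicity

variable {X : Type*} [PseudoEMetricSpace X]

/-- `S` is (the image of) a geodesic from `x` to `y`, parametrized by arc length. -/
def IsGeodesic (x y : X) (S : Set X) : Prop :=
  ∃ (L : ℝ) (γ : ℝ → X), 0 ≤ L ∧ γ 0 = x ∧ γ L = y ∧
    (∀ s ∈ Set.Icc 0 L, ∀ t ∈ Set.Icc 0 L, edist (γ s) (γ t) = ENNReal.ofReal |s - t|) ∧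
    S = γ '' Set.Icc 0 L

/-- The `δ`-neighbourhoods of unions of two sides of `A`, `B`, `C` contain the third side. -/
def IsThin (A B C : Set X) (δ : ℝ≥0∞) : Prop :=
  (∀ p ∈ A, Metric.infEDist p (B ∪ C) ≤ δ) ∧
  (∀ p ∈ B, Metric.infEDist p (C ∪ A) ≤ δ) ∧
  (∀ p ∈ C, Metric.infEDist p (A ∪ B) ≤ δ)

/-- The sharp thin constant of the triangle with sides `A`, `B`, `C`. -/
noncomputable def thinConst (A B C : Set X) : ℝ≥0∞ := sInf {δ | IsThin A B C δ}

variable (X) in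
/-- The sharp hyperbolicity constant: the supremum of the thin constants of all geodesic
triangles (their vertices always lie in one connected component when `X` is a metric graph). -/
noncomputable def hyperbolicityConst : ℝ≥0∞ :=
  sSup {d | ∃ (x y z : X) (A B C : Set X),
    IsGeodesic x y A ∧ IsGeodesic y z B ∧ IsGeodesic z x C ∧ d = thinConst A B C}

end Hyperbolicity

/-- The hyperbolicity constant `δ(G)` of the graph `G`, all of whose edges have length one. -/
noncomputable def graphHyperbolicityConst {V : Type*} (G : SimpleGraph V) : ℝ≥0∞ :=
  hyperbolicityConst (MetricGraph G)

end GromovHyp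

/-! Upper bounds. A point of a geodesic side is within half the side's length of one of its ends, so
the constant is at most half the diameter (`hyperbolicityConst_le_half_diam`). A walk of length `K`
in the product is a pair of walks of length `K` in the factors. The odd cycle has walks of every
length at least `m - 1` between any two vertices, so beyond that only the level difference and its
parity matter, and the diameter is at most `max m (n - 1)` (`edist_cyclePath_le`). For tall products
a point far from both ends of its side has nearly the level of some vertex on the other two sides,
and vertices of equal level are at distance at most `m - 1`; this gives `m - 1/2`
(`graphHyperbolicityConst_cyclePath_le`).

Lower bounds. Since `m` is odd, the cycle coordinate and the parity of the level combine into a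
coordinate on a circle of length `2 * m` (`horiz`), and every edge moves it and the level by one
each: the product is a diagonal grid on a cylinder. Two geodesics with common ends form a bigon
whose midpoint on one side can be far from the other. A bigon around the cylinder gives `m / 2`; one
climbing `N ≤ 2 * m - 1` levels gives `N / 2`. Lengths and distances are bounded below by
1-Lipschitz functions of the two coordinates (`half_le_graphHyperbolicityConst`). -/

namespace GromovHyp

/-! ### Metric graphs and Lipschitz functions on them. -/

namespace MetricGraph

variable {V : Type*} {G : SimpleGraph V}

theorem edgePoint_zero {u v : V} (h : G.Adj u v) : edgePoint h 0 = vertex G u := by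
  ext1; simp [edgePoint, vertex]

theorem edgePoint_one {u v : V} (h : G.Adj u v) : edgePoint h 1 = vertex G v := by
  ext1; simp [edgePoint, vertex]

theorem edgePoint_symm {u v : V} (h : G.Adj u v) (t : Set.Icc (0 : ℝ) 1) :
    edgePoint h.symm (unitInterval.symm t) = edgePoint h t := by
  ext1; simp [edgePoint, add_comm]

theorem eq_vertex_or_eq_edgePoint (p : MetricGraph G) :
    (∃ v, p = vertex G v) ∨ ∃ (u v : V) (h : G.Adj u v) (t : Set.Icc (0 : ℝ) 1),
      p = edgePoint h t := by
  rcases p with ⟨c, ⟨v, rfl⟩ | ⟨u, v, h, t, ht, rfl⟩⟩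
  · exact Or.inl ⟨v, rfl⟩
  · exact Or.inr ⟨u, v, h, ⟨t, ht⟩, rfl⟩

theorem coord_nonneg (p : MetricGraph G) (v : V) : 0 ≤ p.coord v := by
  classical
  obtain ⟨u, rfl⟩ | ⟨u, w, h, t, rfl⟩ := eq_vertex_or_eq_edgePoint p
  · simp only [vertex, Finsupp.single_apply]
    split_ifs <;> norm_num
  · have h0 := t.2.1
    have h1 := t.2.2
    simp only [edgePoint, Finsupp.add_apply, Finsupp.single_apply]
    split_ifs <;> linarith

theorem HasPath.edist_le {p q : MetricGraph G} {ℓ : ℝ≥0} (h : HasPath p q ℓ) :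
    edist p q ≤ ℓ :=
  iInf₂_le ℓ h

theorem edist_edgePoint_le {u v : V} (h : G.Adj u v) (s t : Set.Icc (0 : ℝ) 1) :
    edist (edgePoint h s) (edgePoint h t) ≤ ENNReal.ofReal |(s : ℝ) - t| := by
  refine ((HasPath.step h s t (.refl _)).edist_le).trans_eq ?_
  rw [add_zero, ← edist_nndist, Subtype.edist_eq, edist_dist, Real.dist_eq]

theorem edist_vertex_left_le {u v : V} (h : G.Adj u v) (t : Set.Icc (0 : ℝ) 1) :
    edist (vertex G u) (edgePoint h t) ≤ ENNReal.ofReal t := by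
  rw [← edgePoint_zero h]
  refine (edist_edgePoint_le h _ _).trans_eq ?_
  simp [abs_of_nonneg t.2.1]

theorem edist_vertex_right_le {u v : V} (h : G.Adj u v) (t : Set.Icc (0 : ℝ) 1) :
    edist (vertex G v) (edgePoint h t) ≤ ENNReal.ofReal (1 - t) := by
  rw [← edgePoint_one h]
  refine (edist_edgePoint_le h _ _).trans_eq ?_
  simp [abs_of_nonneg (sub_nonneg.2 t.2.2)]

theorem exists_vertex_edist_le_half (p : MetricGraph G) :
    ∃ v, edist (vertex G v) p ≤ ENNReal.ofReal (1 / 2) := by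
  obtain ⟨v, rfl⟩ | ⟨u, v, h, t, rfl⟩ := eq_vertex_or_eq_edgePoint p
  · exact ⟨v, by simp⟩
  · rcases le_total (t : ℝ) (1 / 2) with ht | ht
    · exact ⟨u, (edist_vertex_left_le h t).trans (ENNReal.ofReal_le_ofReal ht)⟩
    · exact ⟨v, (edist_vertex_right_le h t).trans (ENNReal.ofReal_le_ofReal (by linarith))⟩

/-- A function that is `1`-Lipschitz on every edge is `1`-Lipschitz. -/
theorem ofReal_abs_sub_le_edist {F : MetricGraph G → ℝ}
    (hF : ∀ (u v : V) (h : G.Adj u v) (s t : Set.Icc (0 : ℝ) 1),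
      |F (edgePoint h s) - F (edgePoint h t)| ≤ |(s : ℝ) - t|) (p q : MetricGraph G) :
    ENNReal.ofReal |F p - F q| ≤ edist p q := by
  refine le_iInf₂ fun ℓ h => ?_
  rw [← ENNReal.ofReal_coe_nnreal]
  refine ENNReal.ofReal_le_ofReal ?_
  induction h with
  | refl p => simp
  | @step u v h s t q ℓ _ ih =>
    have h1 := hF u v h s t
    have h2 := abs_sub_le (F (edgePoint h s)) (F (edgePoint h t)) (F q)
    have h3 : ((nndist s t : ℝ≥0) : ℝ) = |(s : ℝ) - t| := by
      rw [coe_nndist, Subtype.dist_eq, Real.dist_eq]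
    push_cast
    rw [← coe_nndist, h3]
    linarith

/-- The extension of a function on the vertices that is affine on the edges. -/
noncomputable def extend (φ : V → ℝ) (p : MetricGraph G) : ℝ :=
  p.coord.sum fun v c => c * φ v

theorem extend_vertex (φ : V → ℝ) (v : V) : extend φ (vertex G v) = φ v := by
  simp [extend, vertex]

theorem extend_edgePoint (φ : V → ℝ) {u v : V} (h : G.Adj u v) (t : Set.Icc (0 : ℝ) 1) :
    extend φ (edgePoint h t) = (1 - t) * φ u + t * φ v := by
  rw [extend, edgePoint, Finsupp.sum_add_index' (by simp) (fun _ _ _ => add_mul _ _ _),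
    Finsupp.sum_single_index (by simp), Finsupp.sum_single_index (by simp)]

/-- The function `φ` changes by at most one along every edge of `G`. -/
def EdgeLipschitz (G : SimpleGraph V) (φ : V → ℝ) : Prop :=
  ∀ ⦃u v⦄, G.Adj u v → |φ u - φ v| ≤ 1

theorem EdgeLipschitz.abs_extend_sub_le {φ : V → ℝ} (hφ : EdgeLipschitz G φ) (u v : V)
    (h : G.Adj u v) (s t : Set.Icc (0 : ℝ) 1) :
    |extend φ (edgePoint h s) - extend φ (edgePoint h t)| ≤ |(s : ℝ) - t| := by
  rw [extend_edgePoint, extend_edgePoint,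
    show (1 - (s : ℝ)) * φ u + s * φ v - ((1 - t) * φ u + t * φ v)
      = ((t : ℝ) - s) * (φ u - φ v) by ring, abs_mul, abs_sub_comm]
  exact mul_le_of_le_one_right (abs_nonneg _) (hφ h)

theorem EdgeLipschitz.ofReal_le_edist {φ : V → ℝ} (hφ : EdgeLipschitz G φ)
    (p q : MetricGraph G) : ENNReal.ofReal |extend φ p - extend φ q| ≤ edist p q :=
  ofReal_abs_sub_le_edist hφ.abs_extend_sub_le p q

theorem EdgeLipschitz.max {φ ψ : V → ℝ} (hφ : EdgeLipschitz G φ) (hψ : EdgeLipschitz G ψ) :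
    EdgeLipschitz G fun v => max (φ v) (ψ v) := fun _ _ h =>
  (abs_max_sub_max_le_max _ _ _ _).trans (max_le (hφ h) (hψ h))

/-- The distance from the midpoint of the edge `[a, b]` is at least the affine extension of `φ` on
the edges that do not contain `a`. -/
theorem EdgeLipschitz.ofReal_le_edist_midpoint {φ : V → ℝ} (hφ : EdgeLipschitz G φ) {a b : V}
    (hab : G.Adj a b) (ha : φ a = 1 / 2) (hb : φ b = 1 / 2) {t₀ : Set.Icc (0 : ℝ) 1}
    (ht₀ : (t₀ : ℝ) = 1 / 2) {q : MetricGraph G} (hq : q.coord a = 0 ∨ q.coord b = 0) :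
    ENNReal.ofReal |extend φ q| ≤ edist (edgePoint hab t₀) q := by
  classical
  -- The affine extension is constantly `1 / 2` on `[a, b]`; subtracting the tent supported on that
  -- edge makes it vanish at the midpoint. Any other edge misses `a` or `b`, so the tent is zero
  -- there.
  have key := ofReal_abs_sub_le_edist (G := G)
    (F := fun p => extend φ p - min (p.coord a) (p.coord b)) ?_ (edgePoint hab t₀) q
  · have h1 : min (q.coord a) (q.coord b) = 0 := by
      rcases hq with h | h
      · rw [h, min_eq_left (coord_nonneg q b)]
      · rw [h, min_eq_right (coord_nonneg q a)]
    have h2 : extend φ (edgePoint hab t₀) = 1 / 2 := by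
      rw [extend_edgePoint, ha, hb]; ring
    have h3 : min ((edgePoint hab t₀).coord a) ((edgePoint hab t₀).coord b) = 1 / 2 := by
      simp [edgePoint, hab.ne, hab.ne', ht₀]; norm_num
    simp only [h1, h2, h3] at key
    simpa using key
  · intro u v h s t
    have hne : u ≠ v := h.ne
    have lip := hφ.abs_extend_sub_le u v h s t
    have hz : ∀ r : Set.Icc (0 : ℝ) 1, ∀ x, x ≠ u → x ≠ v → (edgePoint h r).coord x = 0 := by
      intro r x hu hv
      simp [edgePoint, hu.symm, hv.symm]
    by_cases hau : a = u ∨ a = v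
    · by_cases hbu : b = u ∨ b = v
      · have hu : φ u = 1 / 2 := by
          rcases hau with rfl | rfl <;> rcases hbu with rfl | rfl <;> first | assumption | simp_all
        have hv : φ v = 1 / 2 := by
          rcases hau with rfl | rfl <;> rcases hbu with rfl | rfl <;> first | assumption | simp_all
        have hm : ∀ r : Set.Icc (0 : ℝ) 1,
            min ((edgePoint h r).coord a) ((edgePoint h r).coord b) = min (1 - (r : ℝ)) r := by
          intro r
          rcases hau with rfl | rfl <;> rcases hbu with rfl | rfl
          · exact absurd rfl hab.ne
          · simp [edgePoint, hne, hne.symm]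
          · simp [edgePoint, hne, hne.symm, min_comm]
          · exact absurd rfl hab.ne
        simp only [extend_edgePoint, hu, hv, hm]
        have := abs_min_sub_min_le_max (1 - (s : ℝ)) s (1 - (t : ℝ)) t
        rw [show 1 - (s : ℝ) - (1 - t) = -(s - t) by ring, abs_neg, max_self] at this
        rw [abs_sub_comm] at this
        rwa [show ∀ x y : ℝ, (1 - (s : ℝ)) * (1 / 2) + s * (1 / 2) - x
          - ((1 - (t : ℝ)) * (1 / 2) + t * (1 / 2) - y) = y - x by intros; ring]
      · push Not at hbu
        simpa only [hz _ b hbu.1 hbu.2, min_eq_right (coord_nonneg _ a), sub_zero] using lip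
    · push Not at hau
      simpa only [hz _ a hau.1 hau.2, min_eq_left (coord_nonneg _ b), sub_zero] using lip

end MetricGraph

/-! ### Geodesics and triangles in a general metric space. -/

section Triangles

variable {X : Type*} [PseudoEMetricSpace X] {x y z : X} {A B C : Set X}

theorem IsGeodesic.left_mem (h : IsGeodesic x y A) : x ∈ A := by
  obtain ⟨L, γ, hL, rfl, rfl, -, rfl⟩ := h
  exact ⟨0, ⟨le_rfl, hL⟩, rfl⟩

theorem IsGeodesic.right_mem (h : IsGeodesic x y A) : y ∈ A := by
  obtain ⟨L, γ, hL, rfl, rfl, -, rfl⟩ := h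
  exact ⟨L, ⟨hL, le_rfl⟩, rfl⟩

theorem IsGeodesic.symm (h : IsGeodesic x y A) : IsGeodesic y x A := by
  obtain ⟨L, γ, hL, rfl, rfl, hγ, rfl⟩ := h
  refine ⟨L, fun s => γ (L - s), hL, by simp, by simp, fun s hs t ht => ?_, ?_⟩
  · rw [hγ _ ⟨by linarith [hs.2], by linarith [hs.1]⟩ _ ⟨by linarith [ht.2], by linarith [ht.1]⟩,
      show L - s - (L - t) = -(s - t) by ring, abs_neg]
  · rw [← Set.image_image γ (fun s => L - s), Set.image_const_sub_Icc]
    simp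

theorem isGeodesic_singleton (x : X) : IsGeodesic x x {x} := by
  refine ⟨0, fun _ => x, le_rfl, rfl, rfl, fun s hs t ht => ?_, by simp⟩
  simp only [Set.Icc_self, Set.mem_singleton_iff] at hs ht
  simp [hs, ht]

/-- A point of a geodesic splits its length. -/
theorem IsGeodesic.exists_split {p : X} (h : IsGeodesic x y A) (hp : p ∈ A) :
    ∃ a b : ℝ, 0 ≤ a ∧ 0 ≤ b ∧ edist p x = ENNReal.ofReal a ∧ edist p y = ENNReal.ofReal b ∧
      edist x y = ENNReal.ofReal (a + b) := by
  obtain ⟨L, γ, hL, rfl, rfl, hγ, rfl⟩ := h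
  obtain ⟨s, hs, rfl⟩ := hp
  have h0 : (0 : ℝ) ∈ Set.Icc 0 L := ⟨le_rfl, hL⟩
  have h1 : L ∈ Set.Icc 0 L := ⟨hL, le_rfl⟩
  refine ⟨s, L - s, hs.1, by linarith [hs.2], ?_, ?_, ?_⟩
  · rw [hγ s hs 0 h0, sub_zero, abs_of_nonneg hs.1]
  · rw [hγ s hs L h1, abs_sub_comm, abs_of_nonneg (by linarith [hs.2])]
  · rw [hγ 0 h0 L h1, abs_sub_comm, sub_zero, abs_of_nonneg hL, add_sub_cancel]

/-- Rotating the triangle cyclically reduces thinness to a bound for one side. -/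
theorem hyperbolicityConst_le {δ : ℝ≥0∞}
    (h : ∀ (x y z : X) (A B C : Set X), IsGeodesic x y A → IsGeodesic y z B → IsGeodesic z x C →
      ∀ p ∈ A, Metric.infEDist p (B ∪ C) ≤ δ) : hyperbolicityConst X ≤ δ := by
  refine sSup_le ?_
  rintro _ ⟨x, y, z, A, B, C, hA, hB, hC, rfl⟩
  exact sInf_le ⟨h x y z A B C hA hB hC, h y z x B C A hB hC hA, h z x y C A B hC hA hB⟩

theorem hyperbolicityConst_le_half_diam {D : ℝ} (hD : ∀ p q : X, edist p q ≤ ENNReal.ofReal D) :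
    hyperbolicityConst X ≤ ENNReal.ofReal (D / 2) := by
  refine hyperbolicityConst_le fun x y z A B C hA hB hC p hp => ?_
  obtain ⟨a, b, ha, hb, hpx, hpy, hxy⟩ := hA.exists_split hp
  -- `D` may be negative, in which case `ENNReal.ofReal D` is `0`.
  have hle : a + b ≤ max D 0 := by
    have := hD x y
    rw [hxy] at this
    rcases le_total D 0 with h | h
    · rw [ENNReal.ofReal_of_nonpos h] at this
      have := ENNReal.ofReal_eq_zero.1 (le_antisymm this bot_le)
      exact this.trans (le_max_right _ _)
    · exact ((ENNReal.ofReal_le_ofReal_iff h).1 this).trans (le_max_left _ _)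
  have key : ∀ c, 0 ≤ c → 2 * c ≤ max D 0 → ENNReal.ofReal c ≤ ENNReal.ofReal (D / 2) := by
    intro c hc h
    rcases le_max_iff.1 h with h | h
    · exact ENNReal.ofReal_le_ofReal (by linarith)
    · rw [show c = 0 by linarith]; simp
  rcases le_total a b with h | h
  · exact (Metric.infEDist_le_edist_of_mem (Set.mem_union_right B hC.right_mem)).trans
      (hpx.le.trans (key a ha (by linarith)))
  · exact (Metric.infEDist_le_edist_of_mem (Set.mem_union_left C hB.left_mem)).trans
      (hpy.le.trans (key b hb (by linarith)))

/-- A geodesic bigon, seen as a degenerate triangle, bounds the hyperbolicity constant from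
below. -/
theorem le_hyperbolicityConst_of_bigon {δ : ℝ≥0∞} {p : X} (hA : IsGeodesic x y A)
    (hB : IsGeodesic x y B) (hp : p ∈ A) (h : ∀ q ∈ B, δ ≤ edist p q) :
    δ ≤ hyperbolicityConst X := by
  refine le_trans ?_ (le_sSup ⟨x, y, x, A, B, {x}, hA, hB.symm, isGeodesic_singleton x, rfl⟩)
  refine le_sInf fun d hd => le_trans ?_ (hd.1 p hp)
  refine Metric.le_infEDist.2 fun q hq => ?_
  rcases hq with hq | rfl
  · exact h q hq
  · exact h _ hB.left_mem

/-- Intermediate value theorem along a geodesic. -/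
theorem IsGeodesic.exists_eq {f : X → ℝ} (hf : ∀ p q, ENNReal.ofReal |f p - f q| ≤ edist p q)
    (h : IsGeodesic x y A) {c : ℝ} (hc : c ∈ Set.uIcc (f x) (f y)) : ∃ q ∈ A, f q = c := by
  obtain ⟨L, γ, hL, rfl, rfl, hγ, rfl⟩ := h
  have hcont : ContinuousOn (fun s => f (γ s)) (Set.uIcc 0 L) := by
    rw [Set.uIcc_of_le hL]
    refine (LipschitzOnWith.of_dist_le_mul (K := 1) fun s hs t ht => ?_).continuousOn
    have := (hf (γ s) (γ t)).trans_eq (hγ s hs t ht)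
    rw [ENNReal.ofReal_le_ofReal_iff (abs_nonneg _)] at this
    simpa [Real.dist_eq] using this
  obtain ⟨s, hs, rfl⟩ := intermediate_value_uIcc hcont hc
  rw [Set.uIcc_of_le hL] at hs
  exact ⟨γ s, ⟨s, hs, rfl⟩, rfl⟩

end Triangles

/-! ### Polylines and lower bounds from bigons. -/

namespace MetricGraph

variable {V : Type*} {G : SimpleGraph V}

theorem exists_natCast_add {N : ℕ} (hN : 1 ≤ N) {s : ℝ} (hs : s ∈ Set.Icc (0 : ℝ) N) :
    ∃ i < N, ∃ t : Set.Icc (0 : ℝ) 1, s = i + t := by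
  rcases hs.2.eq_or_lt with h | h
  · refine ⟨N - 1, by omega, 1, ?_⟩
    rw [h, Nat.cast_sub hN]
    simp
  · refine ⟨⌊s⌋₊, (Nat.floor_lt hs.1).2 h, ⟨s - ⌊s⌋₊, ?_, ?_⟩, by simp⟩
    · linarith [Nat.floor_le hs.1]
    · linarith [Nat.lt_floor_add_one s]

/-- The path that runs at unit speed through the vertices `w 0, …, w N`. -/
noncomputable def polyline {w : ℕ → V} {N : ℕ} (hw : ∀ i < N, G.Adj (w i) (w (i + 1))) (s : ℝ) :
    MetricGraph G :=
  if h : ⌊s⌋₊ < N then edgePoint (hw _ h) (Set.projIcc 0 1 zero_le_one (s - ⌊s⌋₊))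
  else vertex G (w N)

variable {w : ℕ → V} {N : ℕ} (hw : ∀ i < N, G.Adj (w i) (w (i + 1)))

theorem polyline_natCast {i : ℕ} (hi : i ≤ N) : polyline hw i = vertex G (w i) := by
  rcases hi.eq_or_lt with rfl | h
  · simp [polyline]
  · rw [polyline, dif_pos (by simpa using h)]
    have : Set.projIcc (0 : ℝ) 1 zero_le_one ((i : ℝ) - ⌊(i : ℝ)⌋₊) = 0 := by
      simp
    rw [this, edgePoint_zero, Nat.floor_natCast]

theorem polyline_add {i : ℕ} (hi : i < N) (t : Set.Icc (0 : ℝ) 1) :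
    polyline hw (i + t) = edgePoint (hw i hi) t := by
  rcases t.2.2.eq_or_lt with h | h
  · have ht : t = 1 := Subtype.ext h
    subst ht
    have := polyline_natCast hw (Nat.succ_le_of_lt hi)
    push_cast at this
    simpa [edgePoint_one] using this
  · have hf : ⌊(i : ℝ) + t⌋₊ = i := by
      rw [Nat.floor_eq_iff (add_nonneg i.cast_nonneg t.2.1)]
      exact ⟨by linarith [t.2.1], by linarith⟩
    rw [polyline, dif_pos (by rwa [hf])]
    ext1
    have : Set.projIcc (0 : ℝ) 1 zero_le_one ((i : ℝ) + t - ⌊(i : ℝ) + t⌋₊) = t := by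
      rw [hf, add_sub_cancel_left]
      exact Set.projIcc_val zero_le_one t
    rw [this]
    simp only [edgePoint, hf]

theorem edist_polyline_le (hN : 1 ≤ N) {s t : ℝ} (hs : 0 ≤ s) (hst : s ≤ t) (ht : t ≤ N) :
    edist (polyline hw s) (polyline hw t) ≤ ENNReal.ofReal (t - s) := by
  obtain ⟨i, hi, a, rfl⟩ := exists_natCast_add hN ⟨hs, hst.trans ht⟩
  have key : ∀ k : ℕ, ∀ t : ℝ, i + (a : ℝ) ≤ t → t ≤ N → t ≤ i + 1 + k →
      edist (polyline hw (i + a)) (polyline hw t) ≤ ENNReal.ofReal (t - (i + a)) := by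
    intro k
    induction k with
    | zero =>
      intro t hst ht htk
      obtain ⟨b, rfl⟩ : ∃ b : Set.Icc (0 : ℝ) 1, t = i + b :=
        ⟨⟨t - i, by linarith [a.2.1], by push_cast at htk; linarith⟩, by simp⟩
      rw [polyline_add hw hi, polyline_add hw hi]
      refine (edist_edgePoint_le _ _ _).trans_eq ?_
      rw [abs_sub_comm, abs_of_nonneg (by linarith)]
      congr 1
      ring
    | succ k ih =>
      intro t hst ht htk
      rcases le_total t (i + 1 + k) with h | h
      · exact ih t hst ht h
      rcases h.eq_or_lt with h' | h'
      · exact ih t hst ht h'.ge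
      have hlt : i + 1 + k < N := by
        have : ((i + 1 + k : ℕ) : ℝ) < N := by push_cast; linarith
        exact_mod_cast this
      obtain ⟨b, rfl⟩ : ∃ b : Set.Icc (0 : ℝ) 1, t = (i + 1 + k : ℕ) + b :=
        ⟨⟨t - (i + 1 + k), by linarith, by push_cast at htk; linarith⟩, by push_cast; simp⟩
      push_cast at h ht
      have hab : (i : ℝ) + a ≤ i + 1 + k := by linarith [a.2.2, (k.cast_nonneg : (0 : ℝ) ≤ k)]
      have h1 := ih (i + 1 + k) hab (h.trans ht) le_rfl
      have h2 := edist_vertex_left_le (hw _ hlt) b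
      rw [polyline_add hw hlt]
      rw [← polyline_natCast hw hlt.le] at h2
      push_cast at h2
      refine (edist_triangle _ _ _).trans ((add_le_add h1 h2).trans_eq ?_)
      rw [← ENNReal.ofReal_add (by linarith) b.2.1]
      congr 1
      push_cast
      ring
  refine key N t hst ht ?_
  linarith [(i.cast_nonneg : (0 : ℝ) ≤ i)]

/-- Unit speed bounds distances from above; `ψ` restricts to arc length on the polyline, so being
1-Lipschitz it bounds them from below. -/
theorem isGeodesic_polyline (hN : 1 ≤ N) {ψ : V → ℝ} (hψ : EdgeLipschitz G ψ)
    (hψw : ∀ i ≤ N, ψ (w i) = i) :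
    IsGeodesic (vertex G (w 0)) (vertex G (w N)) (polyline hw '' Set.Icc (0 : ℝ) N) := by
  refine ⟨N, polyline hw, N.cast_nonneg, ?_, polyline_natCast hw le_rfl, ?_, rfl⟩
  · simpa using polyline_natCast hw N.zero_le
  have hext : ∀ s ∈ Set.Icc (0 : ℝ) N, extend ψ (polyline hw s) = s := by
    intro s hs
    obtain ⟨i, hi, t, rfl⟩ := exists_natCast_add hN hs
    rw [polyline_add hw hi, extend_edgePoint, hψw _ hi.le, hψw _ hi]
    push_cast
    ring
  intro s hs t ht
  refine le_antisymm ?_ ?_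
  · rcases le_total s t with h | h
    · rw [abs_sub_comm, abs_of_nonneg (by linarith)]
      exact edist_polyline_le hw hN hs.1 h ht.2
    · rw [edist_comm, abs_of_nonneg (by linarith)]
      exact edist_polyline_le hw hN ht.1 h hs.2
  · simpa only [hext s hs, hext t ht] using hψ.ofReal_le_edist (polyline hw s) (polyline hw t)

/-- Two geodesics `w`, `w'` of length `N` with the same ends, the midpoint of `w` being at distance
at least `N / 2` from `w'`, force `N / 2 ≤ δ(G)`. -/
theorem half_le_graphHyperbolicityConst {w w' : ℕ → V} {N : ℕ} (hN : 2 ≤ N)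
    (hw : ∀ i < N, G.Adj (w i) (w (i + 1))) (hw' : ∀ i < N, G.Adj (w' i) (w' (i + 1)))
    (h0 : w 0 = w' 0) (h1 : w N = w' N) {ψ φ : V → ℝ} (hψ : EdgeLipschitz G ψ)
    (hφ : EdgeLipschitz G φ) (hψw : ∀ i ≤ N, ψ (w i) = i) (hψw' : ∀ i ≤ N, ψ (w' i) = i)
    (hφw : ∀ i ≤ N, φ (w i) = |(i : ℝ) - N / 2|) (hφw' : ∀ i ≤ N, (N : ℝ) / 2 ≤ φ (w' i)) :
    ENNReal.ofReal ((N : ℝ) / 2) ≤ graphHyperbolicityConst G := by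
  have hN1 : 1 ≤ N := by omega
  have hA := isGeodesic_polyline hw hN1 hψ hψw
  have hB := isGeodesic_polyline hw' hN1 hψ hψw'
  rw [← h0, ← h1] at hB
  have hN2 : (2 : ℝ) ≤ N := by exact_mod_cast hN
  refine le_hyperbolicityConst_of_bigon (p := polyline hw (N / 2)) hA hB
    ⟨N / 2, ⟨by positivity, by linarith⟩, rfl⟩ ?_
  rintro _ ⟨s, hs, rfl⟩
  obtain ⟨j, hj, t, rfl⟩ := exists_natCast_add hN1 hs
  rw [polyline_add hw' hj]
  have hq : (N : ℝ) / 2 ≤ extend φ (edgePoint (hw' j hj) t) := by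
    rw [extend_edgePoint]
    nlinarith [hφw' j hj.le, hφw' (j + 1) hj, t.2.1, t.2.2]
  have hq' : ENNReal.ofReal ((N : ℝ) / 2) ≤
      ENNReal.ofReal |extend φ (edgePoint (hw' j hj) t)| :=
    ENNReal.ofReal_le_ofReal (hq.trans (le_abs_self _))
  refine hq'.trans ?_
  -- For even `N` the midpoint is a vertex where `φ` vanishes. For odd `N` it is the midpoint of an
  -- edge whose ends both have `φ = 1 / 2`, so the plain Lipschitz bound would lose `1 / 2`.
  rcases Nat.even_or_odd' N with ⟨k, hk | hk⟩
  · have hkN : (N : ℝ) / 2 = k := by rw [hk]; push_cast; ring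
    have := hφ.ofReal_le_edist (polyline hw (N / 2)) (edgePoint (hw' j hj) t)
    rw [hkN, polyline_natCast hw (by omega), extend_vertex, hφw k (by omega), hkN] at this
    rw [hkN, polyline_natCast hw (by omega)]
    simpa using this
  · have hkN : (N : ℝ) = 2 * k + 1 := by exact_mod_cast hk
    have hkl : k < N := by omega
    have hk1 : (1 : ℝ) ≤ k := by exact_mod_cast (by omega : 1 ≤ k)
    let t₀ : Set.Icc (0 : ℝ) 1 := ⟨1 / 2, by norm_num, by norm_num⟩
    have hp : (N : ℝ) / 2 = k + (t₀ : ℝ) := by simp only [t₀, hkN]; ring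
    have ha : φ (w k) = 1 / 2 := by
      rw [hφw k hkl.le, hkN, show (k : ℝ) - (2 * k + 1) / 2 = -(1 / 2) by ring, abs_neg]
      norm_num
    have hb : φ (w (k + 1)) = 1 / 2 := by
      rw [hφw _ hkl, hkN]
      push_cast
      rw [show (k : ℝ) + 1 - (2 * k + 1) / 2 = 1 / 2 by ring]
      norm_num
    rw [hp, polyline_add hw hkl]
    refine hφ.ofReal_le_edist_midpoint (hw k hkl) ha hb rfl (Or.inl ?_)
    have hne : ∀ i ≤ N, w' i ≠ w k := fun i hi h => by
      have := hφw' i hi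
      rw [h, ha, hkN] at this
      linarith
    simp [edgePoint, hne j hj.le, hne (j + 1) hj]

/-! ### Paths in direct products and the diameter of bipartite graphs. -/

theorem hasPath_of_walk {U W : Type*} {G : SimpleGraph U} {H : SimpleGraph W} {u u' : U}
    {v v' : W} (p : G.Walk u u') (q : H.Walk v v') (h : p.length = q.length) :
    HasPath (vertex (directProd G H) (u, v)) (vertex (directProd G H) (u', v')) p.length := by
  induction p generalizing v with
  | nil =>
    cases q with
    | nil => simpa using HasPath.refl _
    | cons => simp at h
  | cons hp p ih =>
    cases q with
    | nil => simp at h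
    | cons hq q =>
      have hadj : (directProd G H).Adj (_, _) (_, _) := ⟨hp, hq⟩
      have := HasPath.step hadj 0 1
        (by rw [edgePoint_one]; exact ih q (by simpa using h))
      rw [edgePoint_zero] at this
      convert this using 1
      ext
      rw [NNReal.coe_add, coe_nndist, Subtype.dist_eq, Real.dist_eq]
      simp [add_comm]

/-- In a bipartite graph with colouring `c` modulo two, if two vertices whose distance does not have
the parity of `D` are at distance at most `D - 1`, then the metric graph has diameter at most
`D`. -/
theorem edist_le_of_bipartite {D : ℕ} (c : V → ℤ)
    (hc : ∀ u v, G.Adj u v → (c u + c v) % 2 = 1) (hiso : ∀ u, ∃ v, G.Adj u v)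
    (h1 : ∀ u v, (c u + c v + D) % 2 = 1 →
      edist (vertex G u) (vertex G v) ≤ ENNReal.ofReal (D - 1)) (hD : 1 ≤ D)
    (p q : MetricGraph G) : edist p q ≤ ENNReal.ofReal D := by
  have hedge : ∀ p : MetricGraph G, ∃ (u v : V) (h : G.Adj u v) (t : Set.Icc (0 : ℝ) 1),
      p = edgePoint h t := by
    intro p
    obtain ⟨u, rfl⟩ | h := eq_vertex_or_eq_edgePoint p
    · obtain ⟨v, hv⟩ := hiso u
      exact ⟨u, v, hv, 0, (edgePoint_zero hv).symm⟩
    · exact h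
  have hD' : (1 : ℝ) ≤ D := by exact_mod_cast hD
  obtain ⟨a, b, hab, s, rfl⟩ := hedge p
  obtain ⟨x, y, hxy, t, rfl⟩ := hedge q
  -- The route through `a` and `x` has length at most `s + (D - 1) + t`. If `s + t > 1`, reversing
  -- both edges preserves the parity condition; if the parity is wrong, reversing one edge repairs
  -- it.
  have via : ∀ {a b x y : V} (hab : G.Adj a b) (hxy : G.Adj x y) (s t : Set.Icc (0 : ℝ) 1),
      (c a + c x + D) % 2 = 1 → (s : ℝ) + t ≤ 1 →
      edist (edgePoint hab s) (edgePoint hxy t) ≤ ENNReal.ofReal D := by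
    intro a b x y hab hxy s t hpar hst
    have e1 := edist_vertex_left_le hab s
    have e2 := edist_vertex_left_le hxy t
    rw [edist_comm] at e1
    refine (edist_triangle4 _ (vertex G a) (vertex G x) _).trans
      ((add_le_add (add_le_add e1 (h1 a x hpar)) e2).trans ?_)
    rw [← ENNReal.ofReal_add s.2.1 (by linarith),
      ← ENNReal.ofReal_add (by linarith [s.2.1]) t.2.1]
    exact ENNReal.ofReal_le_ofReal (by linarith)
  have key : ∀ {x y : V} (hxy : G.Adj x y) (t : Set.Icc (0 : ℝ) 1), (c a + c x + D) % 2 = 1 →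
      edist (edgePoint hab s) (edgePoint hxy t) ≤ ENNReal.ofReal D := by
    intro x y hxy t hpar
    have p1 := hc a b hab
    have p2 := hc x y hxy
    rcases le_total ((s : ℝ) + t) 1 with h | h
    · exact via hab hxy s t hpar h
    · rw [← edgePoint_symm hab s, ← edgePoint_symm hxy t]
      refine via hab.symm hxy.symm _ _ (by omega) ?_
      simp only [unitInterval.coe_symm_eq]
      linarith
  have p2 := hc x y hxy
  by_cases hpar : (c a + c x + D) % 2 = 1
  · exact key hxy t hpar
  · rw [← edgePoint_symm hxy t]
    exact key hxy.symm _ (by omega)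

end MetricGraph

/-! ### Walks in cycles and paths, and distances in their product. -/

open MetricGraph
open SimpleGraph hiding edist_comm edist_triangle

variable {m n : ℕ}

theorem cycleGraph_adj_of_mod (hm : 2 ≤ m) {u v : Fin m} (h : (u.val + 1) % m = v.val) :
    (cycleGraph m).Adj u v := by
  refine cycleGraph_adj'.2 (Or.inr ?_)
  have hu := u.isLt
  rw [Fin.sub_def]
  simp only
  rcases (Nat.succ_le_of_lt hu).eq_or_lt with h' | h'
  · rw [← h, show u.val + 1 = m from h', Nat.mod_self, add_zero,
      show m - u.val = 1 by omega, Nat.mod_eq_of_lt (by omega)]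
  · rw [← h, Nat.mod_eq_of_lt (show u.val + 1 < m from h'),
      show m - u.val + (u.val + 1) = 1 + m by omega, Nat.add_mod_right,
      Nat.mod_eq_of_lt (by omega)]

theorem mod_of_cycleGraph_adj {u v : Fin m} (h : (cycleGraph m).Adj u v) :
    (u.val + 1) % m = v.val ∨ (v.val + 1) % m = u.val := by
  have key : ∀ u v : Fin m, (v - u).val = 1 → (u.val + 1) % m = v.val := by
    intro u v h
    have hu := u.isLt
    have hv := v.isLt
    rw [Fin.sub_def] at h
    simp only at h
    rcases lt_or_ge v.val u.val with h' | h'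
    · rw [Nat.mod_eq_of_lt (by omega)] at h
      rw [show u.val + 1 = v.val + m by omega, Nat.add_mod_right, Nat.mod_eq_of_lt hv]
    · rw [show m - u.val + v.val = v.val - u.val + m by omega, Nat.add_mod_right,
        Nat.mod_eq_of_lt (by omega)] at h
      rw [show u.val + 1 = v.val by omega, Nat.mod_eq_of_lt hv]
  exact (cycleGraph_adj'.1 h).symm.imp (key u v) (key v u)

theorem exists_walk_add_two {V : Type*} {G : SimpleGraph V} {u v w : V} (h : G.Adj u w)
    {k : ℕ} (hk : ∃ p : G.Walk u v, p.length = k) (i : ℕ) :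
    ∃ p : G.Walk u v, p.length = k + 2 * i := by
  induction i with
  | zero => simpa using hk
  | succ i ih =>
    obtain ⟨p, hp⟩ := ih
    exact ⟨.cons h (.cons h.symm p), by simp only [Walk.length_cons, hp]; ring⟩

theorem exists_walk_cycleGraph_add (hm : 2 ≤ m) (r : ℕ) (u v : Fin m)
    (h : (u.val + r) % m = v.val) : ∃ p : (cycleGraph m).Walk u v, p.length = r := by
  induction r generalizing u with
  | zero =>
    obtain rfl : u = v := Fin.ext (by rw [← h, add_zero, Nat.mod_eq_of_lt u.isLt])
    exact ⟨.nil, rfl⟩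
  | succ r ih =>
    obtain ⟨p, hp⟩ := ih ⟨(u.val + 1) % m, Nat.mod_lt _ (by omega)⟩ (by
      rw [← h]
      simp only [Nat.mod_add_mod]
      congr 1
      ring)
    exact ⟨.cons (cycleGraph_adj_of_mod hm rfl) p, by simp [hp]⟩

/-- On an odd cycle there are walks of every length at least `m - 1` between any two vertices. -/
theorem exists_walk_cycleGraph (hm : 2 ≤ m) (hodd : Odd m) (u v : Fin m) {K : ℕ}
    (hK : m ≤ K + 1) : ∃ p : (cycleGraph m).Walk u v, p.length = K := by
  have hu := u.isLt
  have hv := v.isLt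
  have hadj : (cycleGraph m).Adj u ⟨(u.val + 1) % m, Nat.mod_lt _ (by omega)⟩ :=
    cycleGraph_adj_of_mod hm rfl
  have fwd : ∀ (u v : Fin m), ∃ r : ℕ, ((r : ℤ) = v.val - u.val ∨ (r : ℤ) = v.val - u.val + m) ∧
      r < m ∧ ∃ p : (cycleGraph m).Walk u v, p.length = r := by
    intro u v
    have hu := u.isLt
    have hv := v.isLt
    rcases le_or_gt u.val v.val with h | h
    · refine ⟨v - u, by omega, by omega, exists_walk_cycleGraph_add hm _ _ _ ?_⟩
      rw [Nat.add_sub_cancel' h, Nat.mod_eq_of_lt hv]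
    · refine ⟨v + m - u, by omega, by omega, exists_walk_cycleGraph_add hm _ _ _ ?_⟩
      rw [show u.val + (v.val + m - u.val) = v.val + m by omega, Nat.add_mod_right,
        Nat.mod_eq_of_lt hv]
  obtain ⟨r, hr, hrm, hp⟩ := fwd u v
  obtain ⟨r', hr', hrm', p, hp'⟩ := fwd v u
  obtain ⟨k, hk⟩ := hodd
  -- For `u ≠ v` the two arcs have odd total length `m`, so one of them has the parity of `K`; both
  -- are shorter than `m` and can be padded by backtracking. For `u = v` and `K` odd, `K ≥ m - 1`
  -- with `m - 1` even forces `K ≥ m`, and a full turn is padded instead.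
  by_cases hpar : (r + K) % 2 = 0
  · obtain ⟨p, hp⟩ := exists_walk_add_two hadj hp ((K - r) / 2)
    exact ⟨p, by omega⟩
  · rcases eq_or_ne u v with rfl | huv
    · obtain ⟨p, hp⟩ := exists_walk_add_two hadj
        (exists_walk_cycleGraph_add hm m u u (by rw [Nat.add_mod_right, Nat.mod_eq_of_lt hu]))
        ((K - m) / 2)
      exact ⟨p, by omega⟩
    · have hne : u.val ≠ v.val := fun h => huv (Fin.ext h)
      obtain ⟨p, hp⟩ := exists_walk_add_two hadj (k := r') ⟨p.reverse, by simp [hp']⟩ ((K - r') / 2)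
      exact ⟨p, by omega⟩

theorem exists_adj_pathGraph (hn : 2 ≤ n) (u : Fin n) : ∃ v, (pathGraph n).Adj u v := by
  rcases Nat.eq_zero_or_pos u.val with h | h
  · exact ⟨⟨1, by omega⟩, pathGraph_adj.2 (Or.inl (by simp [h]))⟩
  · exact ⟨⟨u.val - 1, by omega⟩, pathGraph_adj.2 (Or.inr (by simp; omega))⟩

theorem exists_walk_pathGraph_add (r : ℕ) (u v : Fin n) (h : u.val + r = v.val) :
    ∃ p : (pathGraph n).Walk u v, p.length = r := by
  induction r generalizing u with
  | zero =>
    obtain rfl : u = v := Fin.ext h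
    exact ⟨.nil, rfl⟩
  | succ r ih =>
    have := v.isLt
    obtain ⟨p, hp⟩ := ih ⟨u.val + 1, by omega⟩ (by simp only; omega)
    exact ⟨.cons (pathGraph_adj.2 (Or.inl rfl)) p, by simp [hp]⟩

theorem exists_walk_pathGraph (hn : 2 ≤ n) (u v : Fin n) {K : ℕ} (h1 : u.val ≤ v.val + K)
    (h2 : v.val ≤ u.val + K) (hpar : (u.val + v.val + K) % 2 = 0) :
    ∃ p : (pathGraph n).Walk u v, p.length = K := by
  obtain ⟨w, hw⟩ := exists_adj_pathGraph hn u
  rcases le_total u.val v.val with h | h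
  · obtain ⟨p, hp⟩ := exists_walk_add_two hw
      (exists_walk_pathGraph_add (v.val - u.val) u v (by omega)) ((K - (v.val - u.val)) / 2)
    exact ⟨p, by omega⟩
  · obtain ⟨p, hp⟩ := exists_walk_pathGraph_add (u.val - v.val) v u (by omega)
    obtain ⟨p, hp⟩ := exists_walk_add_two hw (k := u.val - v.val) ⟨p.reverse, by simp [hp]⟩
      ((K - (u.val - v.val)) / 2)
    exact ⟨p, by omega⟩

/-- The product of a cycle and a path. -/
abbrev cyclePath (m n : ℕ) : SimpleGraph (Fin m × Fin n) :=
  directProd (cycleGraph m) (pathGraph n)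

theorem edist_vertex_cyclePath_le (hm : 2 ≤ m) (hodd : Odd m) (hn : 2 ≤ n) (v w : Fin m × Fin n)
    {K : ℕ} (hK : m ≤ K + 1) (h1 : v.2.val ≤ w.2.val + K) (h2 : w.2.val ≤ v.2.val + K)
    (hpar : (v.2.val + w.2.val + K) % 2 = 0) :
    edist (vertex (cyclePath m n) v) (vertex (cyclePath m n) w) ≤ ENNReal.ofReal K := by
  obtain ⟨p, hp⟩ := exists_walk_cycleGraph hm hodd v.1 w.1 hK
  obtain ⟨q, hq⟩ := exists_walk_pathGraph hn v.2 w.2 h1 h2 hpar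
  have := (hasPath_of_walk p q (hp.trans hq.symm)).edist_le
  rw [hp] at this
  simpa using this

theorem edist_cyclePath_le (hm : 3 ≤ m) (hodd : Odd m) (hn : 2 ≤ n)
    (p q : MetricGraph (cyclePath m n)) : edist p q ≤ ENNReal.ofReal (max m (n - 1) : ℕ) := by
  refine edist_le_of_bipartite (fun v => (v.2.val : ℤ)) ?_ ?_ ?_ (by omega) p q
  · intro u v h
    have := pathGraph_adj.1 h.2
    omega
  · intro u
    obtain ⟨w, hw⟩ := exists_adj_pathGraph hn u.2
    exact ⟨(⟨(u.1.val + 1) % m, Nat.mod_lt _ (by omega)⟩, w),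
      cycleGraph_adj_of_mod (by omega) rfl, hw⟩
  · intro u v h
    have hu := u.2.isLt
    have hv := v.2.isLt
    -- The level difference is at most `D = max m (n - 1)` and has the other parity, hence is at
    -- most `D - 1`.
    have := edist_vertex_cyclePath_le (by omega) hodd hn u v (K := max m (n - 1) - 1) (by omega)
      (by omega) (by omega) (by omega)
    rwa [Nat.cast_sub (by omega), Nat.cast_one] at this

/-! ### The level function and the upper bound for tall products. -/

/-- The level of a vertex of the product. -/
def level (v : Fin m × Fin n) : ℝ := v.2.val

theorem edgeLipschitz_level : EdgeLipschitz (cyclePath m n) level := by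
  intro u v h
  unfold level
  rcases pathGraph_adj.1 h.2 with h | h <;> rw [← h] <;> push_cast <;> norm_num

/-- The level changes by exactly one along each edge, so it is an integer only at the ends. -/
theorem exists_vertex_of_extend_level {q : MetricGraph (cyclePath m n)} {j : ℕ}
    (hq : extend level q = j) : ∃ v, q = vertex (cyclePath m n) v ∧ v.2.val = j := by
  obtain ⟨v, rfl⟩ | ⟨u, v, h, t, rfl⟩ := eq_vertex_or_eq_edgePoint q
  · rw [extend_vertex, level] at hq
    exact ⟨v, rfl, by exact_mod_cast hq⟩
  · have ht0 := t.2.1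
    have ht1 := t.2.2
    have key : (t : ℝ) = 0 ∨ (t : ℝ) = 1 := by
      rw [extend_edgePoint, level, level] at hq
      obtain ⟨z, hz⟩ : ∃ z : ℤ, (t : ℝ) = z := by
        rcases pathGraph_adj.1 h.2 with h' | h' <;> rw [← h'] at hq <;> push_cast at hq
        · exact ⟨(j : ℤ) - u.2.val, by push_cast; linarith⟩
        · exact ⟨(v.2.val : ℤ) + 1 - j, by push_cast; linarith⟩
      rw [hz] at ht0 ht1 ⊢
      have h0 : 0 ≤ z := by exact_mod_cast ht0
      have h1 : z ≤ 1 := by exact_mod_cast ht1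
      have : z = 0 ∨ z = 1 := by omega
      exact_mod_cast this
    rcases key with ht | ht
    · obtain rfl : t = 0 := Subtype.ext ht
      rw [edgePoint_zero] at hq ⊢
      rw [extend_vertex, level] at hq
      exact ⟨u, rfl, by exact_mod_cast hq⟩
    · obtain rfl : t = 1 := Subtype.ext ht
      rw [edgePoint_one] at hq ⊢
      rw [extend_vertex, level] at hq
      exact ⟨v, rfl, by exact_mod_cast hq⟩

theorem edist_vertex_le_max_level (hm : 3 ≤ m) (hodd : Odd m) (hn : 2 ≤ n) (v w : Fin m × Fin n) :
    edist (vertex (cyclePath m n) v) (vertex (cyclePath m n) w) ≤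
      ENNReal.ofReal (max m |level v - level w|) := by
  have key : ∀ K : ℕ, m ≤ K + 1 → v.2.val ≤ w.2.val + K → w.2.val ≤ v.2.val + K →
      (v.2.val + w.2.val + K) % 2 = 0 → (K ≤ m ∨ K ≤ max v.2.val w.2.val - min v.2.val w.2.val) →
      edist (vertex (cyclePath m n) v) (vertex (cyclePath m n) w) ≤
        ENNReal.ofReal (max m |level v - level w|) := by
    intro K h1 h2 h3 h4 h5
    refine (edist_vertex_cyclePath_le (by omega) hodd hn v w h1 h2 h3 h4).trans
      (ENNReal.ofReal_le_ofReal ?_)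
    rcases h5 with h5 | h5
    · exact le_max_of_le_left (by exact_mod_cast h5)
    · refine le_max_of_le_right ?_
      have : (K : ℤ) ≤ |(v.2.val : ℤ) - w.2.val| := by
        rcases le_total v.2.val w.2.val with h | h
        · rw [abs_sub_comm, abs_of_nonneg] <;> omega
        · rw [abs_of_nonneg] <;> omega
      have h : ((K : ℤ) : ℝ) ≤ ((|(v.2.val : ℤ) - w.2.val| : ℤ) : ℝ) := Int.cast_le.2 this
      simpa [level] using h
  obtain ⟨k, hk⟩ := hodd
  rcases le_or_gt m (max v.2.val w.2.val - min v.2.val w.2.val) with h | h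
  · exact key _ (by omega) (by omega) (by omega) (by omega) (Or.inr le_rfl)
  · by_cases hpar : (v.2.val + w.2.val) % 2 = 0
    · exact key (m - 1) (by omega) (by omega) (by omega) (by omega) (Or.inl (by omega))
    · exact key m (by omega) (by omega) (by omega) (by omega) (Or.inl le_rfl)

theorem graphHyperbolicityConst_cyclePath_le (hm : 3 ≤ m) (hodd : Odd m) (hn : 2 ≤ n) :
    graphHyperbolicityConst (cyclePath m n) ≤ ENNReal.ofReal ((m : ℝ) - 1 / 2) := by
  have hm' : (3 : ℝ) ≤ m := by exact_mod_cast hm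
  refine hyperbolicityConst_le fun x y z A B C hA hB hC p hp => ?_
  obtain ⟨a, b, ha, hb, hpx, hpy, hxy⟩ := hA.exists_split hp
  rcases le_or_gt a ((m : ℝ) - 1 / 2) with ham | ham
  · exact (Metric.infEDist_le_edist_of_mem (Set.mem_union_right B hC.right_mem)).trans
      (hpx.le.trans (ENNReal.ofReal_le_ofReal ham))
  rcases le_or_gt b ((m : ℝ) - 1 / 2) with hbm | hbm
  · exact (Metric.infEDist_le_edist_of_mem (Set.mem_union_left C hB.left_mem)).trans
      (hpy.le.trans (ENNReal.ofReal_le_ofReal hbm))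
  have lip := (edgeLipschitz_level (m := m) (n := n)).ofReal_le_edist
  have lip' : ∀ {p q : MetricGraph (cyclePath m n)} {d : ℝ}, 0 ≤ d → edist p q ≤ ENNReal.ofReal d →
      |extend level p - extend level q| ≤ d := fun hd h =>
    (ENNReal.ofReal_le_ofReal_iff hd).1 ((lip _ _).trans h)
  obtain ⟨p₀, hp₀⟩ := exists_vertex_edist_le_half p
  obtain ⟨x₀, hx₀⟩ := exists_vertex_edist_le_half x
  obtain ⟨y₀, hy₀⟩ := exists_vertex_edist_le_half y
  have lp := lip' ha hpx.le
  have lp' := lip' hb hpy.le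
  have lp₀ := lip' (by norm_num) hp₀
  have lx₀ := lip' (by norm_num) hx₀
  have ly₀ := lip' (by norm_num) hy₀
  rw [extend_vertex] at lp₀ lx₀ ly₀
  have hlen : a + b ≤ 1 / 2 + max (m : ℝ) |level x₀ - level y₀| + 1 / 2 := by
    have hmax : (0 : ℝ) ≤ max (m : ℝ) |level x₀ - level y₀| := le_max_of_le_left (by positivity)
    rw [edist_comm] at hx₀
    have := (edist_triangle4 x (vertex _ x₀) (vertex _ y₀) y).trans
      (add_le_add (add_le_add hx₀ (edist_vertex_le_max_level hm hodd hn x₀ y₀)) hy₀)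
    rw [hxy, ← ENNReal.ofReal_add (by norm_num) hmax,
      ← ENNReal.ofReal_add (by linarith) (by norm_num)] at this
    exact (ENNReal.ofReal_le_ofReal_iff (by linarith)).1 this
  -- As `a + b > 2 * m - 1 ≥ m + 1`, the maximum in `hlen` must be the level difference. Replacing
  -- `x`, `y`, `p` by nearby vertices costs at most `5 / 2` in total, and `a`, `b` exceed `m - 1 / 2
  -- ≥ 5 / 2`; this is where `m ≥ 3` enters.
  have hmem : level p₀ ∈ Set.uIcc (extend level x) (extend level y) := by
    have h1 := abs_le.1 lp
    have h2 := abs_le.1 lp'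
    have h3 := abs_le.1 lp₀
    have h4 := abs_le.1 lx₀
    have h5 := abs_le.1 ly₀
    rcases max_cases (m : ℝ) |level x₀ - level y₀| with ⟨h, -⟩ | ⟨h, -⟩
    · rw [h] at hlen
      linarith
    · rw [h] at hlen
      rcases abs_cases (level x₀ - level y₀) with ⟨h', -⟩ | ⟨h', -⟩ <;> rw [h'] at hlen
      · exact Set.mem_uIcc.2 (Or.inr ⟨by linarith, by linarith⟩)
      · exact Set.mem_uIcc.2 (Or.inl ⟨by linarith, by linarith⟩)
  obtain ⟨q, hq, hqp⟩ : ∃ q ∈ B ∪ C, extend level q = level p₀ := by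
    rw [Set.uIcc_comm] at hmem
    rcases Set.uIcc_subset_uIcc_union_uIcc (b := extend level z) hmem with h | h
    · obtain ⟨q, hq, h⟩ := hB.exists_eq lip h
      exact ⟨q, Or.inl hq, h⟩
    · obtain ⟨q, hq, h⟩ := hC.exists_eq lip h
      exact ⟨q, Or.inr hq, h⟩
  refine (Metric.infEDist_le_edist_of_mem hq).trans ?_
  obtain ⟨v, rfl, hv⟩ := exists_vertex_of_extend_level hqp
  -- Equal levels require an even `K`, and `m - 1` is even.
  have hvp := edist_vertex_cyclePath_le (by omega) hodd hn p₀ v (K := m - 1) (by omega) (by omega)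
    (by omega) (by obtain ⟨k, hk⟩ := hodd; omega)
  rw [edist_comm] at hp₀
  refine (edist_triangle _ _ _).trans ((add_le_add hp₀ hvp).trans_eq ?_)
  rw [← ENNReal.ofReal_add (by norm_num) (by positivity), Nat.cast_sub (by omega)]
  congr 1
  push_cast
  ring

/-! ### The horizontal coordinate. -/

/-- The horizontal coordinate of a vertex of the product, on a circle of length `2 * m`. -/
noncomputable def horiz (v : Fin m × Fin n) : AddCircle (2 * m : ℝ) :=
  ((v.1.val + m * (v.1.val + v.2.val) : ℤ) : ℝ)

/-- Chinese remainder theorem for the coprime moduli `2` and `m`: the integer defining `horiz` is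
congruent to the cycle coordinate modulo `m` and to the level modulo `2`. -/
theorem horiz_eq (hodd : Odd m) (v : Fin m × Fin n) {x : ℤ} (h1 : (m : ℤ) ∣ x - v.1.val)
    (h2 : (2 : ℤ) ∣ x - v.2.val) : horiz v = ((x : ℝ) : AddCircle (2 * m : ℝ)) := by
  obtain ⟨k, hk⟩ := hodd
  have hk' : (m : ℤ) = 2 * k + 1 := by exact_mod_cast hk
  have hcop : IsCoprime (2 : ℤ) m := ⟨-k, 1, by rw [hk']; ring⟩
  obtain ⟨z, hz⟩ : (2 * m : ℤ) ∣ (v.1.val + m * (v.1.val + v.2.val)) - x := by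
    refine hcop.mul_dvd ?_ ?_
    · obtain ⟨c, hc⟩ := h2
      exact ⟨v.1.val + k * (v.1.val + v.2.val) - c, by rw [hk']; linear_combination -hc⟩
    · obtain ⟨c, hc⟩ := h1
      exact ⟨v.1.val + v.2.val - c, by linear_combination -hc⟩
  rw [horiz, ← sub_eq_zero, ← AddCircle.coe_sub, ← Int.cast_sub, hz, AddCircle.coe_eq_zero_iff]
  exact ⟨z, by push_cast; rw [zsmul_eq_mul]; ring⟩

theorem horiz_add_one (hodd : Odd m) {u v : Fin m × Fin n} (h : (u.1.val + 1) % m = v.1.val)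
    (h' : (pathGraph n).Adj u.2 v.2) : horiz v = horiz u + ((1 : ℝ) : AddCircle (2 * m : ℝ)) := by
  obtain ⟨k, hk⟩ := hodd
  have hk' : (m : ℤ) = 2 * k + 1 := by exact_mod_cast hk
  rw [horiz_eq (x := (u.1.val + m * (u.1.val + u.2.val)) + 1) ⟨k, hk⟩ v, horiz, ← AddCircle.coe_add]
  · push_cast
    rfl
  · have := Nat.div_add_mod (u.1.val + 1) m
    rw [h] at this
    zify at this
    exact ⟨u.1.val + u.2.val + ((u.1.val + 1) / m : ℤ), by linear_combination -this⟩
  · obtain ⟨c, hc⟩ : (2 : ℤ) ∣ (u.2.val : ℤ) + 1 - v.2.val := by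
      have := pathGraph_adj.1 h'
      omega
    exact ⟨u.1.val + k * (u.1.val + u.2.val) + c, by rw [hk']; linear_combination hc⟩

theorem norm_coe_of_abs_le (hm : 1 ≤ m) {x : ℝ} (hx : |x| ≤ m) :
    ‖(x : AddCircle (2 * m : ℝ))‖ = |x| := by
  have : (1 : ℝ) ≤ m := by exact_mod_cast hm
  rw [AddCircle.norm_coe_eq_abs_iff _ (by positivity), abs_of_nonneg (a := (2 * m : ℝ)) (by positivity)]
  linarith

theorem le_norm_coe (hm : 1 ≤ m) {x d : ℝ} (hd : 0 ≤ d) (h1 : d ≤ x) (h2 : x ≤ 2 * m - d) :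
    d ≤ ‖(x : AddCircle (2 * m : ℝ))‖ := by
  rcases le_total x m with h | h
  · rw [norm_coe_of_abs_le hm (by rwa [abs_of_nonneg (hd.trans h1)])]
    exact h1.trans (le_abs_self x)
  · have : (x : AddCircle (2 * m : ℝ)) = ((x - 2 * m : ℝ) : AddCircle (2 * m : ℝ)) := by
      rw [AddCircle.coe_sub, AddCircle.coe_period, sub_zero]
    have habs : |x - 2 * m| = 2 * m - x := by
      rw [abs_sub_comm, abs_of_nonneg (by linarith)]
    rw [this, norm_coe_of_abs_le hm (by rw [habs]; linarith), habs]
    linarith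

theorem edgeLipschitz_horiz (hm : 1 ≤ m) (hodd : Odd m) (c : ℝ) :
    EdgeLipschitz (cyclePath m n) fun v => ‖horiz v - (c : AddCircle (2 * m : ℝ))‖ := by
  have hm' : (1 : ℝ) ≤ m := by exact_mod_cast hm
  have h1 : ‖((1 : ℝ) : AddCircle (2 * m : ℝ))‖ = 1 := by
    rw [norm_coe_of_abs_le hm (by simpa using hm'), abs_one]
  intro u v h
  refine (abs_norm_sub_norm_le _ _).trans ?_
  rw [sub_sub_sub_cancel_right]
  rcases mod_of_cycleGraph_adj h.1 with h' | h'
  · rw [horiz_add_one hodd h' h.2, norm_sub_rev, add_sub_cancel_left, h1]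
  · rw [horiz_add_one hodd h' h.2.symm, add_sub_cancel_left, h1]

/-! ### The extremal bigons. -/

section Coordinates

variable [NeZero m] [NeZero n]

/-- The vertex of the product with horizontal coordinate `x` and level `j`, for `x` and `j` of the
same parity. -/
def ofCoords (m n : ℕ) [NeZero m] [NeZero n] (x j : ℕ) : Fin m × Fin n :=
  (Fin.ofNat m x, Fin.ofNat n j)

theorem level_ofCoords {x j : ℕ} (hj : j < n) : level (ofCoords m n x j) = j := by
  simp [level, ofCoords, Nat.mod_eq_of_lt hj]

theorem horiz_ofCoords (hodd : Odd m) {x j : ℕ} (hj : j < n) (h : (x + j) % 2 = 0) :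
    horiz (ofCoords m n x j) = ((x : ℝ) : AddCircle (2 * m : ℝ)) := by
  have := horiz_eq hodd (ofCoords m n x j) (x := x) ?_ ?_
  · simpa using this
  · exact ⟨x / m, by simp only [ofCoords, Fin.val_ofNat]; push_cast; linarith [Int.mul_ediv_add_emod x m]⟩
  · simp only [ofCoords, Fin.val_ofNat, Nat.mod_eq_of_lt hj]
    omega

theorem adj_ofCoords (hm : 2 ≤ m) {x y i j : ℕ} (hi : i < n) (hj : j < n)
    (h : i + 1 = j ∨ j + 1 = i) (hxy : (x + 1) % m = y % m ∨ (y + 1) % m = x % m) :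
    (cyclePath m n).Adj (ofCoords m n x i) (ofCoords m n y j) := by
  refine ⟨?_, pathGraph_adj.2 ?_⟩
  · rcases hxy with h | h
    · exact cycleGraph_adj_of_mod hm (by simpa [ofCoords] using h)
    · exact (cycleGraph_adj_of_mod hm (by simpa [ofCoords] using h)).symm
  · simpa [ofCoords, Nat.mod_eq_of_lt hi, Nat.mod_eq_of_lt hj] using h

/-- The bigon consists of the two half circles from `0` to `m`, zigzagging between levels `0` and
`1`; `φ` is the circular distance to `m / 2`. -/
theorem half_le_graphHyperbolicityConst_cyclePath (hm : 3 ≤ m) (hodd : Odd m) (hn : 2 ≤ n) :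
    ENNReal.ofReal ((m : ℝ) / 2) ≤ graphHyperbolicityConst (cyclePath m n) := by
  have hm1 : 1 ≤ m := by omega
  have hm' : (3 : ℝ) ≤ m := by exact_mod_cast hm
  have hlt : ∀ i, i % 2 < n := fun i => by omega
  have hle : ∀ {i : ℕ}, i ≤ m → (i : ℝ) ≤ m := fun h => by exact_mod_cast h
  have hw' : ∀ i ≤ m, horiz (ofCoords m n (2 * m - i) (i % 2)) =
      ((-i : ℝ) : AddCircle (2 * m : ℝ)) := by
    intro i hi
    rw [horiz_ofCoords hodd (hlt _) (by omega), Nat.cast_sub (by omega), AddCircle.coe_sub]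
    push_cast
    rw [AddCircle.coe_period, zero_sub, AddCircle.coe_neg]
  refine half_le_graphHyperbolicityConst (w := fun i => ofCoords m n i (i % 2))
    (w' := fun i => ofCoords m n (2 * m - i) (i % 2)) (by omega) ?_ ?_ ?_ ?_
    (edgeLipschitz_horiz hm1 hodd 0) (edgeLipschitz_horiz hm1 hodd (m / 2)) ?_ ?_ ?_ ?_
  · intro i _
    exact adj_ofCoords (by omega) (hlt _) (hlt _) (by omega) (Or.inl rfl)
  · intro i hi
    refine adj_ofCoords (by omega) (hlt _) (hlt _) (by omega) (Or.inr ?_)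
    congr 1
    omega
  · simp [ofCoords, Fin.ext_iff]
  · simp only [show 2 * m - m = m by omega]
  · intro i hi
    rw [horiz_ofCoords hodd (hlt _) (by omega), AddCircle.coe_zero, sub_zero, norm_coe_of_abs_le hm1] <;>
      rw [abs_of_nonneg (by positivity)]
    exact hle hi
  · intro i hi
    rw [hw' i hi, AddCircle.coe_zero, sub_zero, norm_coe_of_abs_le hm1] <;>
      rw [abs_neg, abs_of_nonneg (by positivity)]
    exact hle hi
  · intro i hi
    rw [horiz_ofCoords hodd (hlt _) (by omega), ← AddCircle.coe_sub, norm_coe_of_abs_le hm1]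
    have := hle hi
    exact abs_le.2 ⟨by linarith [(i.cast_nonneg : (0 : ℝ) ≤ i)], by linarith⟩
  · intro i hi
    have := hle hi
    have h0 : (0 : ℝ) ≤ i := i.cast_nonneg
    rw [hw' i hi, ← AddCircle.coe_sub, ← norm_neg, ← AddCircle.coe_neg]
    exact le_norm_coe hm1 (by linarith) (by linarith) (by linarith)

/-- Both sides climb from level `0` to `N`. One swings out to horizontal coordinate about `N / 2`
and back, the other oscillates between `0` and `-1`; `φ` is the sup distance to the point at
coordinate `N / 2` and level `N / 2`. The circular distance from `-1` to `N / 2` is at least `N / 2`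
exactly when `N ≤ 2 * m - 1`. -/
theorem half_height_le_graphHyperbolicityConst_cyclePath (hm : 3 ≤ m) (hodd : Odd m) {N : ℕ}
    (hN : 2 ≤ N) (hNm : N + 1 ≤ 2 * m) (hNn : N + 1 ≤ n) :
    ENNReal.ofReal ((N : ℝ) / 2) ≤ graphHyperbolicityConst (cyclePath m n) := by
  have hm1 : 1 ≤ m := by omega
  have hNm' : (N : ℝ) + 1 ≤ 2 * m := by exact_mod_cast hNm
  have hN0 : (2 : ℝ) ≤ N := by exact_mod_cast hN
  have hlt : ∀ i ≤ N, i < n := fun i hi => by omega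
  have hle : ∀ {i : ℕ}, i ≤ N → (i : ℝ) ≤ N := fun h => by exact_mod_cast h
  let X : ℕ → ℕ := fun i => min i (2 * ((N + 1) / 2) - i)
  -- `2 * m - 1` stands for `-1`. For odd `N` the side `X` ends at `1`, so the last step of `X'`
  -- goes there; the level alone gives `φ = N / 2` at that end.
  let X' : ℕ → ℕ := fun i => if i % 2 = 0 then 0 else if i = N then 1 else 2 * m - 1
  have hX : ∀ i, (i : ℕ) ≤ N → (X i + i) % 2 = 0 := fun i hi => by simp only [X]; omega
  have hX' : ∀ i, (i : ℕ) ≤ N → (X' i + i) % 2 = 0 := fun i hi => by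
    simp only [X']; split_ifs <;> omega
  refine half_le_graphHyperbolicityConst (w := fun i => ofCoords m n (X i) i)
    (w' := fun i => ofCoords m n (X' i) i) hN ?_ ?_ ?_ ?_
    edgeLipschitz_level ((edgeLipschitz_horiz hm1 hodd (N / 2)).max
      (φ := fun v => ‖horiz v - ((N / 2 : ℝ) : AddCircle (2 * m : ℝ))‖)
      (ψ := fun v => |level v - N / 2|) ?_) ?_ ?_ ?_ ?_
  · intro i hi
    refine adj_ofCoords (by omega) (hlt _ hi.le) (hlt _ hi) (Or.inl rfl) ?_
    have : X i + 1 = X (i + 1) ∨ X (i + 1) + 1 = X i := by simp only [X]; omega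
    exact this.imp (congrArg (· % m)) (congrArg (· % m))
  · intro i hi
    refine adj_ofCoords (by omega) (hlt _ hi.le) (hlt _ hi) (Or.inl rfl) ?_
    have h2 : (2 * m - 1 + 1) % m = 0 % m := by
      rw [show 2 * m - 1 + 1 = 0 + m * 2 by omega, Nat.add_mul_mod_self_left]
    simp only [X']
    split_ifs <;> first | omega | exact Or.inl rfl
  · simp [X, X']
  · have : X N = X' N := by
      simp only [X, X']
      split_ifs <;> omega
    simp only [this]
  · intro u v h
    refine (abs_abs_sub_abs_le _ _).trans ?_
    rw [sub_sub_sub_cancel_right]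
    exact edgeLipschitz_level h
  · intro i hi
    exact level_ofCoords (hlt i hi)
  · intro i hi
    exact level_ofCoords (hlt i hi)
  · intro i hi
    rw [level_ofCoords (hlt i hi), horiz_ofCoords hodd (hlt i hi) (hX i hi), ← AddCircle.coe_sub]
    refine max_eq_right ?_
    have hbd : |(X i : ℝ) - N / 2| ≤ |(i : ℝ) - N / 2| := by
      have h1 : X i = i ∨ (N + 1) / 2 ≤ i ∧ X i ≤ i ∧ N ≤ X i + i := by
        simp only [X]; omega
      rcases h1 with h1 | ⟨h1, h2, h3⟩
      · rw [h1]
      · have h2' : (X i : ℝ) ≤ i := by exact_mod_cast h2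
        have h3' : (N : ℝ) ≤ X i + i := by exact_mod_cast h3
        refine abs_le_abs ?_ ?_ <;> linarith
    refine le_trans (le_of_eq (norm_coe_of_abs_le hm1 ?_)) hbd
    refine hbd.trans (abs_le.2 ⟨?_, ?_⟩) <;> linarith [hle hi, (i.cast_nonneg : (0 : ℝ) ≤ i)]
  · intro i hi
    by_cases hiN : i % 2 = 1 ∧ i = N
    · refine le_max_of_le_right ?_
      rw [level_ofCoords (hlt i hi), hiN.2]
      exact le_trans (by linarith) (le_abs_self _)
    · refine le_max_of_le_left ?_
      rw [horiz_ofCoords hodd (hlt i hi) (hX' i hi), ← AddCircle.coe_sub]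
      simp only [X']
      split_ifs with h1 h2
      · rw [Nat.cast_zero, ← norm_neg, ← AddCircle.coe_neg]
        exact le_norm_coe hm1 (by linarith) (by linarith) (by linarith)
      · omega
      · rw [Nat.cast_sub (by omega)]
        push_cast
        exact le_norm_coe hm1 (by linarith) (by linarith) (by linarith)

end Coordinates

end GromovHyp

theorem mainTheorem11 (m n : ℕ) (hm : 3 ≤ m) (hodd : Odd m) (hn : 2 ≤ n) :
    (n - 1 ≤ m →
      GromovHyp.graphHyperbolicityConst
          (GromovHyp.directProd (SimpleGraph.cycleGraph m) (SimpleGraph.pathGraph n)) =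
        ENNReal.ofReal ((m : ℝ) / 2)) ∧
    (m < n - 1 → n - 1 < 2 * m →
      GromovHyp.graphHyperbolicityConst
          (GromovHyp.directProd (SimpleGraph.cycleGraph m) (SimpleGraph.pathGraph n)) =
        ENNReal.ofReal (((n : ℝ) - 1) / 2)) ∧
    (2 * m ≤ n - 1 →
      GromovHyp.graphHyperbolicityConst
          (GromovHyp.directProd (SimpleGraph.cycleGraph m) (SimpleGraph.pathGraph n)) =
        ENNReal.ofReal ((m : ℝ) - 1 / 2)) := by
  have : NeZero m := ⟨by omega⟩
  have : NeZero n := ⟨by omega⟩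
  have hn1 : ((n - 1 : ℕ) : ℝ) = n - 1 := by rw [Nat.cast_sub (by omega), Nat.cast_one]
  have hdiam := GromovHyp.hyperbolicityConst_le_half_diam
    (GromovHyp.edist_cyclePath_le (n := n) hm hodd hn)
  refine ⟨fun h => ?_, fun h1 h2 => ?_, fun h => ?_⟩
  · rw [max_eq_left h] at hdiam
    exact hdiam.antisymm (GromovHyp.half_le_graphHyperbolicityConst_cyclePath hm hodd hn)
  · rw [max_eq_right h1.le, hn1] at hdiam
    refine hdiam.antisymm ?_
    rw [← hn1]
    exact GromovHyp.half_height_le_graphHyperbolicityConst_cyclePath hm hodd (by omega) (by omega)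
      (by omega)
  · refine (GromovHyp.graphHyperbolicityConst_cyclePath_le hm hodd hn).antisymm ?_
    -- The tallest admissible bigon, `N = 2 * m - 1`, fits since `n ≥ 2 * m`.
    have := GromovHyp.half_height_le_graphHyperbolicityConst_cyclePath (n := n) hm hodd
      (N := 2 * m - 1) (by omega) (by omega) (by omega)
    rw [Nat.cast_sub (by omega)] at this
    push_cast at this
    rwa [show (2 * (m : ℝ) - 1) / 2 = m - 1 / 2 by ring] at this
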